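/- Let $R$ be a complete discrete valuation ring with uniformizer $\pi$, fraction field $K$ and residue field $k$, both of characteristic zero. All group schemes are affine, and $R[U]$ denotes the ring of functions of an affine $R$-scheme $U$. Let $U$ be a group scheme which is flat and of finite type over $R$ and unipotent, i.e. $U\otimes_R K$ and $U\otimes_R k$ are unipotent group schemes over $K$ and $k$ respectively (every nonzero linear representation has a nonzero fixed vector). Let $\mathfrak U$ be the $\pi$-adic completion of $U$; it is a formal group scheme over $R$, namely a group object in the category of affine $R$-adic formal schemes, with ring of functions the $\pi$-adic completion $R[U]^\wedge$. Then, for every closed formal subgroup scheme $\mathfrak H\subset\mathfrak U$ which is flat over $R$, there exists a closed subgroup scheme $H\subset U$, flat over $R$, which induces $\mathfrak H$; that is, the $\pi$-adic completion $\widehat H$ and $\mathfrak H$ are the same closed formal subscheme of $\mathfrak U$ (the ideal of $R[U]^\wedge$ cutting out $\mathfrak H$ is the kernel of $R[U]^\wedge\to R[H]^\wedge$). -/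

import Mathlib

open scoped TensorProduct

/-! Affine group schemes over a ring `R` are represented by their commutative Hopf `R`-algebras of
functions, affine `R`-adic formal schemes by their adically complete `R`-algebras of functions. -/

/-! ### Unipotent group schemes over a field -/

section Unipotent

universe u v

/-- A (right) comodule structure `V → V ⊗ H`, i.e. a linear representation on the `F`-vector
space `V` of the affine group scheme with Hopf algebra `H`. -/
structure IsCoaction {F : Type*} {H : Type*} {V : Type*} [Field F] [CommRing H] [HopfAlgebra F H]
    [AddCommGroup V] [Module F V] (ρ : V →ₗ[F] V ⊗[F] H) : Prop where
  coassoc : (TensorProduct.assoc F V H H).toLinearMap ∘ₗ ρ.rTensor H ∘ₗ ρ =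
    (Coalgebra.comul (R := F) (A := H)).lTensor V ∘ₗ ρ
  counit : (TensorProduct.rid F V).toLinearMap ∘ₗ
    (Coalgebra.counit (R := F) (A := H)).lTensor V ∘ₗ ρ = LinearMap.id

/-- The affine group scheme over the field `F` with Hopf algebra `H` is unipotent: every nonzero
linear representation has a nonzero fixed vector. -/
def IsUnipotentHopf (F : Type u) (H : Type v) [Field F] [CommRing H] [HopfAlgebra F H] : Prop :=
  ∀ (V : Type v) [AddCommGroup V] [Module F V] [Nontrivial V] (ρ : V →ₗ[F] V ⊗[F] H),
    IsCoaction ρ → ∃ v : V, v ≠ 0 ∧ ρ v = v ⊗ₜ[F] (1 : H)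

/-- The affine group scheme over the local domain `R` with Hopf algebra `A` has unipotent generic
and closed fibres. -/
def HasUnipotentFibres (R : Type u) (A : Type v) [CommRing R] [IsDomain R] [IsLocalRing R]
    [CommRing A] [HopfAlgebra R A] : Prop :=
  IsUnipotentHopf (FractionRing R) (FractionRing R ⊗[R] A) ∧
    IsUnipotentHopf (IsLocalRing.ResidueField R) (IsLocalRing.ResidueField R ⊗[R] A)

end Unipotent

/-! ### Completion along the closed fibre -/

section Completion

variable (R : Type*) [CommRing R] [IsLocalRing R]

/-- The ideal `π B` of an `R`-algebra `B` (extension of the maximal ideal of `R`). -/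
abbrev piIdeal (B : Type*) [CommRing B] [Algebra R B] : Ideal B :=
  (IsLocalRing.maximalIdeal R).map (algebraMap R B)

/-- The `π`-adic completion of an `R`-algebra `B`: the ring of functions on the completion of
`Spec B` along its closed fibre. -/
abbrev PiCompletion (B : Type*) [CommRing B] [Algebra R B] : Type _ :=
  AdicCompletion (piIdeal R B) B

variable {R}
variable {B C : Type*} [CommRing B] [Algebra R B] [CommRing C] [Algebra R C]

theorem piIdeal_pow_le_comap (f : B →ₐ[R] C) (n : ℕ) :
    piIdeal R B ^ n ≤ (piIdeal R C ^ n).comap f := by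
  rw [← Ideal.map_le_iff_le_comap, Ideal.map_pow]
  refine Ideal.pow_right_mono ?_ n
  rw [piIdeal, Ideal.map_le_iff_le_comap, Ideal.map_le_iff_le_comap]
  intro x hx
  rw [Ideal.mem_comap, Ideal.mem_comap, AlgHom.commutes]
  exact Ideal.mem_map_of_mem _ hx

theorem PiCompletion.map_compat (f : B →ₐ[R] C) {m n : ℕ} (hle : m ≤ n) :
    (Ideal.Quotient.factorₐ R (Ideal.pow_le_pow_right hle)).comp
        ((Ideal.quotientMapₐ (piIdeal R C ^ n) f (piIdeal_pow_le_comap f n)).comp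
          ((AdicCompletion.evalₐ (piIdeal R B) n).restrictScalars R)) =
      (Ideal.quotientMapₐ (piIdeal R C ^ m) f (piIdeal_pow_le_comap f m)).comp
        ((AdicCompletion.evalₐ (piIdeal R B) m).restrictScalars R) := by
  ext x
  obtain ⟨b, hb⟩ := Ideal.Quotient.mk_surjective (AdicCompletion.evalₐ (piIdeal R B) n x)
  have hb' : AdicCompletion.evalₐ (piIdeal R B) m x = Ideal.Quotient.mk _ b := by
    obtain ⟨y, rfl⟩ := AdicCompletion.mk_surjective _ _ x
    rw [AdicCompletion.evalₐ_mk] at hb ⊢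
    rw [Ideal.Quotient.eq] at hb ⊢
    have h1 := Ideal.pow_le_pow_right hle hb
    have h2 := y.2 hle
    rw [SModEq.sub_mem, smul_eq_mul, Ideal.mul_top] at h2
    have h3 := sub_mem h2 h1
    rwa [sub_sub_sub_cancel_right] at h3
  simp only [AlgHom.comp_apply, AlgHom.restrictScalars_apply, hb', ← hb]
  rfl

/-- The map of `π`-adic completions induced by a morphism of `R`-algebras: it is
`f mod πⁿ : B / πⁿ B → C / πⁿ C` at each level `n`. -/
noncomputable def PiCompletion.map (f : B →ₐ[R] C) : PiCompletion R B →ₐ[R] PiCompletion R C :=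
  AdicCompletion.liftAlgHom (piIdeal R C)
    (fun n => (Ideal.quotientMapₐ (piIdeal R C ^ n) f (piIdeal_pow_le_comap f n)).comp
      ((AdicCompletion.evalₐ (piIdeal R B) n).restrictScalars R))
    (PiCompletion.map_compat f)

theorem PiCompletion.evalₐ_map (f : B →ₐ[R] C) (n : ℕ) (x : PiCompletion R B) :
    AdicCompletion.evalₐ (piIdeal R C) n (PiCompletion.map f x) =
      Ideal.quotientMapₐ (piIdeal R C ^ n) f (piIdeal_pow_le_comap f n)
        (AdicCompletion.evalₐ (piIdeal R B) n x) :=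
  AdicCompletion.evalₐ_liftAlgHom (piIdeal R C) _ (PiCompletion.map_compat f) n x

/-- The quotient `B → B̂ → B̂ / J` for an ideal `J` of `B̂`. -/
noncomputable def PiCompletion.toQuotient (J : Ideal (PiCompletion R B)) :
    B →ₐ[R] (PiCompletion R B ⧸ J) :=
  (Ideal.Quotient.mkₐ R J).comp (Algebra.algHom R B (PiCompletion R B))

end Completion

/-! ### Closed formal subgroups of the completion of a group scheme -/

section FormalSubgroup

variable {R : Type*} [CommRing R] [IsLocalRing R] {A : Type*} [CommRing A] [HopfAlgebra R A]

/-- Let `𝔘` be the formal group scheme obtained by completing the group scheme with Hopf algebra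
`A`. The ideal `J` of `𝒪(𝔘) = Â` cuts out a closed formal subgroup scheme `ℌ` of `𝔘`: the ring
`Q = Â / J` is adically complete, so that `ℌ = Spf Q` is a closed formal subscheme, the unit
section and the inversion of `𝔘` restrict to `ℌ`, and so does the multiplication, that is,
`Â → (A ⊗ A)^ → (Q ⊗ Q)^ = 𝒪(ℌ × ℌ)` vanishes on `J`. -/
structure IsClosedFormalSubgroup (J : Ideal (PiCompletion R A)) : Prop where
  complete : IsAdicComplete (IsLocalRing.maximalIdeal R) (PiCompletion R A ⧸ J)
  counit : ∀ x ∈ J, PiCompletion.map (Bialgebra.counitAlgHom R A) x = 0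
  antipode : ∀ x ∈ J, PiCompletion.map (HopfAlgebra.antipodeAlgHom R A) x ∈ J
  comul : ∀ x ∈ J,
    PiCompletion.map
      (Algebra.TensorProduct.map (PiCompletion.toQuotient J) (PiCompletion.toQuotient J))
      (PiCompletion.map (Bialgebra.comulAlgHom R A) x) = 0

/-- The ideal of `Â` cutting out the completion of the closed subscheme `V(I)` of `Spec A`: the
kernel of `Â → (A / I)^`. -/
noncomputable def completionIdeal (I : Ideal A) : Ideal (PiCompletion R A) :=
  RingHom.ker (PiCompletion.map (Ideal.Quotient.mkₐ R I))

end FormalSubgroup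

/-!
The argument rests on the one-parameter subgroups `t ↦ gᵗ` of a unipotent group in characteristic
zero. Since the residue field has characteristic zero, `ℚ ⊆ R`. If the generic fibre of `Spec A` is
unipotent, then `id - ηε` is locally nilpotent for convolution on `A`
(`IsUnipotentHopf.exists_convPow_eq_zero`, descended along the injection `A → K ⊗ A`), so the binomial
expansion of `id = 1 + (id - ηε)` shows that `a (gⁿ)` is a polynomial in `n` for every `a ∈ A`
(`HasUnipotentFibres.hasPolynomialPowers`). This gives an algebra map `A → A[T]`,
`a ↦ a (gᵀ) = Σ eᵢ(a) Tⁱ`. Here `e₁` is a derivation at the unit section, so its image is a finitely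
generated `R`-module; `e₁ * eᵢ = (i + 1) eᵢ₊₁` for convolution; and `Σ eᵢ(a) = a`.

Let `J` be the ideal of a closed formal subgroup, `Jₙ ⊆ A` (`levelIdeal`) the ideal of functions which
vanish on it modulo `πⁿ`, and `I = J ∩ A = ⋂ Jₙ`. Modulo `πⁿ` the formal subgroup is an honest
subgroup, hence stable under all power maps, and therefore under all `eᵢ`. The relation above then
shows that `Jₙ` is generated by `e₁(Jₙ)` modulo `πⁿ` (`HasPolynomialPowers.sub_counit_mem`). But
`e₁(A)` is finite over the complete ring `R`, so `e₁` of a convergent sequence of elements of the `Jₙ`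
has a limit in `e₁(A)`, which lies in `I`; this yields `e₁(Jₙ) ⊆ I + πⁿ A`. Hence
`Jₙ = I + πⁿ A` for all `n` (`IsClosedFormalSubgroup.levelIdeal_eq_sup`), which says that the
completion of `V(I)` is the given formal subgroup. Flatness of `A / I ⊆ Â / J` is clear, and the
coideal property of `I` follows from that of all the `Jₙ` by Krull's intersection theorem, applied to
the images of the finite-rank maps `eᵢ ⊗ eⱼ`.
-/

/-! ### Polynomial interpolation of the power maps of a group scheme -/

section PowerMaps

open Polynomial WithConv Coalgebra

/-- As `B` need not be a domain, the identity is checked after applying `ℚ`-linear functionals to the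
coefficients. -/
theorem Polynomial.eq_of_eval_natCast_eq {B : Type*} [CommRing B] [Algebra ℚ B] {p q : B[X]}
    (h : ∀ n : ℕ, p.eval (n : B) = q.eval (n : B)) : p = q := by
  rw [← sub_eq_zero]
  ext i
  rw [coeff_zero, ← Module.forall_dual_apply_eq_zero_iff ℚ]
  intro φ
  set r := p - q with hr
  have hr0 : ∀ n : ℕ, r.eval (n : B) = 0 := fun n => by rw [hr, eval_sub, h, sub_self]
  let s : ℚ[X] := ∑ k ∈ Finset.range (r.natDegree + 1), monomial k (φ (r.coeff k))
  have hs : s = 0 := by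
    refine eq_zero_of_infinite_isRoot s
      ((Set.infinite_range_of_injective (Nat.cast_injective (R := ℚ))).mono ?_)
    rintro _ ⟨n, rfl⟩
    have := congrArg φ (hr0 n)
    rw [eval_eq_sum_range, map_sum, map_zero] at this
    simp only [Set.mem_ofPred_eq, IsRoot.def, s, eval_finsetSum, eval_monomial]
    rw [← this]
    refine Finset.sum_congr rfl fun k _ => ?_
    have : r.coeff k * (n : B) ^ k = ((n : ℚ) ^ k) • r.coeff k := by
      rw [Algebra.smul_def, map_pow, map_natCast, mul_comm]
    rw [this, map_smul, smul_eq_mul, mul_comm]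
  have hc := congrArg (fun t : ℚ[X] => t.coeff i) hs
  simp only [s, finsetSum_coeff, coeff_monomial, coeff_zero, Finset.sum_ite_eq',
    Finset.mem_range] at hc
  split_ifs at hc with hi
  · exact hc
  · rw [coeff_eq_zero_of_natDegree_lt (by lia), map_zero]

variable (R : Type*) [CommRing R] {A : Type*} [CommRing A] [Bialgebra R A]

variable (A) in
/-- The algebra map `A → A` dual to the `n`-th power map `g ↦ gⁿ` of `Spec A`. -/
noncomputable def powHom (n : ℕ) : A →ₐ[R] A := (toConv (AlgHom.id R A) ^ n).ofConv

variable (A) in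
/-- The power maps `g ↦ gⁿ` of `Spec A` depend polynomially on `n`. -/
def HasPolynomialPowers : Prop := ∀ a : A, ∃ p : A[X], ∀ n : ℕ, p.eval (n : A) = powHom R A n a

theorem toConv_powHom (n : ℕ) :
    toConv (powHom R A n).toLinearMap = (toConv LinearMap.id : WithConv (A →ₗ[R] A)) ^ n :=
  AlgHom.toLinearMap_convPow _ n

theorem powHom_zero (a : A) : powHom R A 0 a = algebraMap R A (counit a) := rfl

theorem powHom_one (a : A) : powHom R A 1 a = a := by
  rw [powHom, pow_one]; rfl

variable {R} in
theorem sum_powHom_mul_powHom {a : A} {ι : Type*} (r : Repr R a ι) (m n : ℕ) :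
    ∑ i ∈ r.index, powHom R A m (r.left i) * powHom R A n (r.right i) = powHom R A (m + n) a := by
  have h : toConv (powHom R A (m + n)).toLinearMap =
      toConv (powHom R A m).toLinearMap * toConv (powHom R A n).toLinearMap := by
    simp only [toConv_powHom, pow_add]
  have := r.convMul_apply (toConv (powHom R A m).toLinearMap) (toConv (powHom R A n).toLinearMap)
  rw [← h] at this
  exact this.symm

variable [Algebra ℚ A] (hA : HasPolynomialPowers R A)

namespace HasPolynomialPowers

variable {R}

/-- The algebra map `A → A[T]` dual to `(g, t) ↦ gᵗ`. -/
noncomputable def powPoly : A →ₐ[R] A[X] :=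
  AlgHom.ofLinearMap
    { toFun := fun a => (hA a).choose
      map_add' := fun a b => eq_of_eval_natCast_eq fun n => by
        rw [eval_add, (hA _).choose_spec, (hA _).choose_spec, (hA _).choose_spec, map_add]
      map_smul' := fun r a => eq_of_eval_natCast_eq fun n => by
        rw [RingHom.id_apply, eval_smul, (hA _).choose_spec, (hA _).choose_spec, map_smul] }
    (eq_of_eval_natCast_eq fun n => by
      change (hA _).choose.eval _ = _
      rw [(hA _).choose_spec, map_one, eval_one])
    (fun a b => eq_of_eval_natCast_eq fun n => by
      change (hA _).choose.eval _ = ((hA _).choose * (hA _).choose).eval _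
      rw [eval_mul, (hA _).choose_spec, (hA _).choose_spec, (hA _).choose_spec, map_mul])

@[simp]
theorem eval_powPoly (n : ℕ) (a : A) : (hA.powPoly a).eval (n : A) = powHom R A n a :=
  (hA a).choose_spec n

/-- The coefficient of `Tⁱ` in the function `a (gᵗ)`; for `i = 1` it is the logarithm of the
identity with respect to convolution, and in general `logⁱ / i!`. -/
noncomputable def component (i : ℕ) : A →ₗ[R] A :=
  (lcoeff A i).restrictScalars R ∘ₗ hA.powPoly.toLinearMap

theorem component_apply (i : ℕ) (a : A) : hA.component i a = (hA.powPoly a).coeff i := rfl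

theorem component_zero (a : A) : hA.component 0 a = algebraMap R A (counit a) := by
  rw [component_apply, coeff_zero_eq_eval_zero, ← Nat.cast_zero, eval_powPoly, powHom_zero]

/-- Evaluation of `a (gᵗ)` at `t = 1`. -/
theorem sum_component {a : A} {N : ℕ} (hN : (hA.powPoly a).natDegree < N) :
    ∑ i ∈ Finset.range N, hA.component i a = a := by
  conv_rhs => rw [← powHom_one R a, ← eval_powPoly hA, Nat.cast_one, eval_eq_sum_range' hN]
  simp [component_apply]

theorem component_one_mul (a b : A) : hA.component 1 (a * b) =
    algebraMap R A (counit a) * hA.component 1 b + hA.component 1 a * algebraMap R A (counit b) := by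
  rw [← component_zero hA, ← component_zero hA]
  simp only [component_apply, map_mul, coeff_mul, Finset.Nat.antidiagonal_succ,
    Finset.Nat.antidiagonal_zero]
  simp

theorem component_one_algebraMap (r : R) : hA.component 1 (algebraMap R A r) = 0 := by
  rw [component_apply, AlgHom.commutes, IsScalarTower.algebraMap_apply R A A[X],
    algebraMap_eq, coeff_C]
  simp

/-- The differential equation `d/dt a(gᵗ) = Σ log(a₁)(g) a₂(gᵗ)`, coefficient by coefficient. -/
theorem sum_component_one_mul_component {a : A} {ι : Type*} (r : Repr R a ι) (i : ℕ) :
    ∑ k ∈ r.index, hA.component 1 (r.left k) * hA.component i (r.right k) =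
      (i + 1 : ℕ) * hA.component (i + 1) a := by
  -- The identity `g ^ T * g ^ n = g ^ (T + n)`, first for `T ∈ ℕ`; its linear term in `T` is then
  -- compared for all `n`, and interpolated once more.
  have key (n : ℕ) : ∑ k ∈ r.index, hA.powPoly (r.left k) * C (powHom R A n (r.right k)) =
      taylor (n : A) (hA.powPoly a) := eq_of_eval_natCast_eq fun m => by
    simp only [eval_finsetSum, eval_mul, eval_C, eval_powPoly, sum_powHom_mul_powHom,
      taylor_eval, ← Nat.cast_add]
  have hder : ∑ k ∈ r.index, C (hA.component 1 (r.left k)) * hA.powPoly (r.right k) =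
      derivative (hA.powPoly a) := eq_of_eval_natCast_eq fun n => by
    rw [← taylor_coeff_one, ← key]
    simp [eval_finsetSum, component_apply]
  have := congrArg (fun p : A[X] => p.coeff i) hder
  simpa [finsetSum_coeff, coeff_derivative, component_apply, mul_comm] using this

end HasPolynomialPowers

end PowerMaps

/-! ### Unipotent groups: the power maps are polynomial -/

section UnipotentFiltration

open TensorProduct Coalgebra WithConv

universe u v

variable (F : Type u) (H : Type v) [Field F] [CommRing H] [HopfAlgebra F H]

/-- The map `h ↦ Δ h - h ⊗ 1`, whose kernel is the space of fixed vectors of the regular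
representation. -/
noncomputable def comulDefect : H →ₗ[F] H ⊗[F] H := comul - (TensorProduct.mk F H H).flip 1

/-- The ascending filtration of `H` whose `n + 1`-st step is the preimage of the translation
invariants in `H / Wₙ`. -/
noncomputable def unipotentFiltration : ℕ → Submodule F H
  | 0 => ⊥
  | n + 1 => LinearMap.ker
      ((unipotentFiltration n).mkQ.rTensor H ∘ₗ comulDefect F H)

variable {F H}

theorem comulDefect_apply (h : H) : comulDefect F H h = comul (R := F) h - h ⊗ₜ 1 := rfl

theorem mem_unipotentFiltration_succ {n : ℕ} {h : H} :
    h ∈ unipotentFiltration F H (n + 1) ↔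
      (unipotentFiltration F H n).mkQ.rTensor H (comulDefect F H h) = 0 := Iff.rfl

/-- Coassociativity moves the defect `Δ - · ⊗ 1` of the first tensor factor to the defect `Δ - 1 ⊗ ·`
of the second one, which vanishes at `1`. -/
theorem rTensor_comulDefect_comul (h : H) :
    (comulDefect F H).rTensor H (comul h) = (TensorProduct.assoc F H H H).symm
      ((comul - TensorProduct.mk F H H 1).lTensor H (comul h)) := by
  have h1 : ((TensorProduct.mk F H H).flip 1).rTensor H =
      (TensorProduct.assoc F H H H).symm.toLinearMap ∘ₗ (TensorProduct.mk F H H 1).lTensor H := by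
    ext; rfl
  rw [comulDefect, LinearMap.rTensor_sub, LinearMap.lTensor_sub, LinearMap.sub_apply,
    LinearMap.sub_apply, map_sub, h1, ← coassoc_symm_apply]
  rfl

/-- Every step of the filtration is a subcomodule of `H`. -/
theorem rTensor_mkQ_comul_of_mem {n : ℕ} {h : H} (hh : h ∈ unipotentFiltration F H n) :
    (unipotentFiltration F H n).mkQ.rTensor H (comul h) = 0 := by
  cases n with
  | zero =>
    have : h = 0 := hh
    rw [this, map_zero, map_zero]
  | succ n =>
    set q := (unipotentFiltration F H n).mkQ
    let φ := q.rTensor H ∘ₗ comulDefect F H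
    -- `ψ` embeds `H / Wₙ₊₁` into `(H / Wₙ) ⊗ H`, which reduces the claim to a computation with `φ`.
    let ψ := (unipotentFiltration F H (n + 1)).liftQ φ le_rfl
    have hψ : Function.Injective ψ := by
      rw [← LinearMap.ker_eq_bot]
      exact Submodule.ker_liftQ_eq_bot' _ _ rfl
    apply Module.Flat.rTensor_preserves_injective_linearMap (M := H) ψ hψ
    rw [map_zero, ← LinearMap.comp_apply, ← LinearMap.rTensor_comp,
      show ψ ∘ₗ (unipotentFiltration F H (n + 1)).mkQ = φ from Submodule.liftQ_mkQ _ _ _,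
      LinearMap.rTensor_comp, LinearMap.comp_apply, rTensor_comulDefect_comul]
    have hq : q.rTensor H (comul h) = q h ⊗ₜ 1 := by
      have := mem_unipotentFiltration_succ.mp hh
      rwa [comulDefect_apply, map_sub, LinearMap.rTensor_tmul, sub_eq_zero] at this
    have hassoc : (q.rTensor H).rTensor H ∘ₗ (TensorProduct.assoc F H H H).symm.toLinearMap =
        (TensorProduct.assoc F _ H H).symm.toLinearMap ∘ₗ q.rTensor (H ⊗[F] H) := by
      ext; rfl
    have hswap : q.rTensor (H ⊗[F] H) ∘ₗ (comul - TensorProduct.mk F H H 1).lTensor H =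
        (comul - TensorProduct.mk F H H 1).lTensor _ ∘ₗ q.rTensor H := by
      rw [LinearMap.rTensor_comp_lTensor, LinearMap.lTensor_comp_rTensor]
    have e1 := LinearMap.congr_fun hassoc
      ((comul - TensorProduct.mk F H H 1).lTensor H (comul h))
    have e2 := LinearMap.congr_fun hswap (comul h)
    simp only [LinearMap.comp_apply, LinearEquiv.coe_coe] at e1 e2
    rw [e1, e2, hq, LinearMap.lTensor_tmul, LinearMap.sub_apply, Bialgebra.comul_one,
      Algebra.TensorProduct.one_def, TensorProduct.mk_apply, sub_self, tmul_zero, map_zero]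

theorem unipotentFiltration_mono : Monotone (unipotentFiltration F H) :=
  monotone_nat_of_le_succ fun n h hh => by
    rw [mem_unipotentFiltration_succ, comulDefect_apply, map_sub, rTensor_mkQ_comul_of_mem hh,
      LinearMap.rTensor_tmul, Submodule.mkQ_apply, (Submodule.Quotient.mk_eq_zero _).mpr hh,
      zero_tmul, sub_zero]

/-- If `H` is unipotent then the filtration is exhaustive: otherwise the quotient of `H` by its
union would be a nonzero representation without fixed vectors. -/
theorem IsUnipotentHopf.iSup_unipotentFiltration (hH : IsUnipotentHopf F H) :
    ⨆ n, unipotentFiltration F H n = ⊤ := by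
  set W := ⨆ n, unipotentFiltration F H n with hW
  by_contra hne
  have : Nontrivial (H ⧸ W) := Submodule.Quotient.nontrivial_iff.mpr hne
  have hmem (h : H) : h ∈ W ↔ ∃ n, h ∈ unipotentFiltration F H n :=
    Submodule.mem_iSup_of_directed _ unipotentFiltration_mono.directed_le
  have hker : W ≤ LinearMap.ker (W.mkQ.rTensor H ∘ₗ comul) := by
    intro h hh
    obtain ⟨n, hn⟩ := (hmem h).mp hh
    have hle : unipotentFiltration F H n ≤ W := le_iSup _ n
    have : W.mkQ = Submodule.factor hle ∘ₗ (unipotentFiltration F H n).mkQ := rfl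
    rw [LinearMap.mem_ker, LinearMap.comp_apply, this, LinearMap.rTensor_comp,
      LinearMap.comp_apply, rTensor_mkQ_comul_of_mem hn, map_zero]
  let ρ : H ⧸ W →ₗ[F] (H ⧸ W) ⊗[F] H := W.liftQ _ hker
  have hρ : ρ ∘ₗ W.mkQ = W.mkQ.rTensor H ∘ₗ comul := W.liftQ_mkQ _ hker
  have hρ' (h : H) : ρ (W.mkQ h) = W.mkQ.rTensor H (comul h) := LinearMap.congr_fun hρ h
  have hco : IsCoaction ρ := by
    constructor
    · apply W.linearMap_qext
      ext h
      have h1 : (TensorProduct.assoc F (H ⧸ W) H H).toLinearMap ∘ₗ (W.mkQ.rTensor H).rTensor H =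
          W.mkQ.rTensor (H ⊗[F] H) ∘ₗ (TensorProduct.assoc F H H H).toLinearMap := by
        ext; rfl
      have h2 : ρ.rTensor H ∘ₗ W.mkQ.rTensor H =
          (W.mkQ.rTensor H).rTensor H ∘ₗ (comul (R := F) (A := H)).rTensor H := by
        rw [← LinearMap.rTensor_comp, hρ, LinearMap.rTensor_comp]
      have h3 : (comul (R := F) (A := H)).lTensor (H ⧸ W) ∘ₗ W.mkQ.rTensor H =
          W.mkQ.rTensor (H ⊗[F] H) ∘ₗ (comul (R := F) (A := H)).lTensor H := by
        rw [LinearMap.rTensor_comp_lTensor, LinearMap.lTensor_comp_rTensor]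
      have e1 := LinearMap.congr_fun h1 ((comul (R := F) (A := H)).rTensor H (comul h))
      have e2 := LinearMap.congr_fun h2 (comul h)
      have e3 := LinearMap.congr_fun h3 (comul h)
      simp only [LinearMap.comp_apply, LinearEquiv.coe_coe] at e1 e2 e3 ⊢
      rw [hρ', e2, e1, e3, coassoc_apply]
    · apply W.linearMap_qext
      ext h
      have h3 : (counit (R := F) (A := H)).lTensor (H ⧸ W) ∘ₗ W.mkQ.rTensor H =
          W.mkQ.rTensor F ∘ₗ (counit (R := F) (A := H)).lTensor H := by
        rw [LinearMap.rTensor_comp_lTensor, LinearMap.lTensor_comp_rTensor]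
      have e3 := LinearMap.congr_fun h3 (comul h)
      simp only [LinearMap.comp_apply, LinearEquiv.coe_coe] at e3 ⊢
      rw [hρ', e3, lTensor_counit_comul, LinearMap.rTensor_tmul, rid_tmul, one_smul,
        LinearMap.id_apply]
  obtain ⟨v, hv0, hv⟩ := hH (H ⧸ W) ρ hco
  obtain ⟨h, rfl⟩ := W.mkQ_surjective v
  rw [hρ'] at hv
  have hδ : W.mkQ.rTensor H (comulDefect F H h) = 0 := by
    rw [comulDefect_apply, map_sub, hv, LinearMap.rTensor_tmul, sub_self]
  obtain ⟨x, hx⟩ := (rTensor_exact H (LinearMap.exact_subtype_mkQ W) W.mkQ_surjective _).mp hδ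
  have hfin (x : W ⊗[F] H) :
      ∃ n, (unipotentFiltration F H n).mkQ.rTensor H (W.subtype.rTensor H x) = 0 := by
    induction x with
    | zero => exact ⟨0, by simp⟩
    | tmul w g =>
      obtain ⟨n, hn⟩ := (hmem w).mp w.2
      refine ⟨n, ?_⟩
      rw [LinearMap.rTensor_tmul, LinearMap.rTensor_tmul, Submodule.mkQ_apply,
        Submodule.subtype_apply, (Submodule.Quotient.mk_eq_zero _).mpr hn, zero_tmul]
    | add x y hx hy =>
      obtain ⟨m, hm⟩ := hx
      obtain ⟨n, hn⟩ := hy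
      have up {k : ℕ} (hk : k ≤ max m n) {z : H ⊗[F] H}
          (hz : (unipotentFiltration F H k).mkQ.rTensor H z = 0) :
          (unipotentFiltration F H (max m n)).mkQ.rTensor H z = 0 := by
        have : (unipotentFiltration F H (max m n)).mkQ =
          Submodule.factor (unipotentFiltration_mono hk) ∘ₗ (unipotentFiltration F H k).mkQ := rfl
        rw [this, LinearMap.rTensor_comp, LinearMap.comp_apply, hz, map_zero]
      exact ⟨max m n, by
        rw [map_add, map_add, up (le_max_left _ _) hm, up (le_max_right _ _) hn, add_zero]⟩
  obtain ⟨n, hn⟩ := hfin x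
  rw [hx] at hn
  exact hv0 ((Submodule.Quotient.mk_eq_zero _).mpr ((hmem h).mpr ⟨n + 1, hn⟩))

/-- As `id - ηε` kills `1`, its convolution with any map kills `h ⊗ 1` and factors through the defect
`Δ h - h ⊗ 1`. -/
theorem convPow_id_sub_one_apply_of_mem {n : ℕ} {h : H} (hh : h ∈ unipotentFiltration F H n) :
    ((toConv LinearMap.id - 1 : WithConv (H →ₗ[F] H)) ^ n) h = 0 := by
  induction n generalizing h with
  | zero =>
    have : h = 0 := hh
    rw [this, map_zero]
  | succ n ih =>
    set w : WithConv (H →ₗ[F] H) := toConv LinearMap.id - 1 with hw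
    have hw1 : w 1 = 0 := by
      change (1 : H) - algebraMap F H (counit 1) = 0
      simp
    have hle : unipotentFiltration F H n ≤ LinearMap.ker (w ^ n).ofConv := fun h hh => ih hh
    have hfac : TensorProduct.map (w ^ n).ofConv w.ofConv =
        TensorProduct.map ((unipotentFiltration F H n).liftQ _ hle) w.ofConv ∘ₗ
          (unipotentFiltration F H n).mkQ.rTensor H := by
      rw [LinearMap.map_comp_rTensor, Submodule.liftQ_mkQ]
    have hz : TensorProduct.map (w ^ n).ofConv w.ofConv (h ⊗ₜ 1) = 0 := by
      rw [TensorProduct.map_tmul]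
      exact (congrArg _ hw1).trans (tmul_zero _ _)
    have hcomul : comul h = comulDefect F H h + h ⊗ₜ 1 := by
      rw [comulDefect_apply, sub_add_cancel]
    rw [pow_succ, LinearMap.convMul_apply, hcomul, map_add, hz, hfac, LinearMap.comp_apply,
      mem_unipotentFiltration_succ.mp hh, map_zero, add_zero, map_zero]

theorem IsUnipotentHopf.exists_convPow_eq_zero (hH : IsUnipotentHopf F H) (h : H) :
    ∃ N, ∀ n ≥ N, ((toConv LinearMap.id - 1 : WithConv (H →ₗ[F] H)) ^ n) h = 0 := by
  have hh : h ∈ ⨆ n, unipotentFiltration F H n := by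
    rw [hH.iSup_unipotentFiltration]; trivial
  obtain ⟨N, hN⟩ :=
    (Submodule.mem_iSup_of_directed _ unipotentFiltration_mono.directed_le).mp hh
  exact ⟨N, fun n hn => convPow_id_sub_one_apply_of_mem (unipotentFiltration_mono hn hN)⟩

end UnipotentFiltration

section PolynomialPowers

open TensorProduct Coalgebra WithConv Polynomial

section BaseChange

variable {R K A : Type*} [CommRing R] [CommRing K] [Algebra R K] [CommRing A] [HopfAlgebra R A]

theorem convOne_baseChange (a : A) :
    (1 : WithConv ((K ⊗[R] A) →ₗ[K] (K ⊗[R] A))) (1 ⊗ₜ a) =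
      1 ⊗ₜ (1 : WithConv (A →ₗ[R] A)) a := by
  rw [LinearMap.convOne_apply, LinearMap.convOne_apply, counit_tmul,
    CommSemiring.counit_apply, Algebra.algebraMap_eq_smul_one, smul_assoc, one_smul,
    Algebra.TensorProduct.one_def, ← tmul_smul, ← Algebra.algebraMap_eq_smul_one]

theorem convMul_baseChange {f g : WithConv (A →ₗ[R] A)}
    {f' g' : WithConv ((K ⊗[R] A) →ₗ[K] (K ⊗[R] A))}
    (hf : ∀ a, f' (1 ⊗ₜ a) = 1 ⊗ₜ f a) (hg : ∀ a, g' (1 ⊗ₜ a) = 1 ⊗ₜ g a) (a : A) :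
    (f' * g') (1 ⊗ₜ a) = 1 ⊗ₜ (f * g) a := by
  let r := ℛ R a
  let s : Repr K ((1 : K) ⊗ₜ[R] a) _ :=
    { index := r.index
      left := fun i => 1 ⊗ₜ r.left i
      right := fun i => 1 ⊗ₜ r.right i
      eq := by
        rw [comul_tmul, ← r.eq, tmul_sum, map_sum, CommSemiring.comul_apply]
        rfl }
  rw [s.convMul_apply, r.convMul_apply, tmul_sum]
  refine Finset.sum_congr rfl fun i _ => ?_
  rw [hf, hg, Algebra.TensorProduct.tmul_mul_tmul, one_mul]

theorem convPow_id_sub_one_baseChange (n : ℕ) (a : A) :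
    ((toConv LinearMap.id - 1 : WithConv ((K ⊗[R] A) →ₗ[K] (K ⊗[R] A))) ^ n) (1 ⊗ₜ a) =
      1 ⊗ₜ ((toConv LinearMap.id - 1 : WithConv (A →ₗ[R] A)) ^ n) a := by
  induction n generalizing a with
  | zero => rw [pow_zero, pow_zero, convOne_baseChange]
  | succ n ih =>
    rw [pow_succ, pow_succ]
    refine convMul_baseChange ih (fun b => ?_) a
    rw [WithConv.ofConv_sub, WithConv.ofConv_sub, LinearMap.sub_apply, LinearMap.sub_apply,
      convOne_baseChange, tmul_sub]
    rfl

end BaseChange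

/-- The binomial expansion of `id = 1 + (id - ηε)` has boundedly many terms on a given element. -/
theorem HasPolynomialPowers.of_convPow_eq_zero {R A : Type*} [CommRing R] [CommRing A]
    [Bialgebra R A] [Algebra ℚ A]
    (h : ∀ a : A, ∃ N, ∀ n ≥ N, ((toConv LinearMap.id - 1 : WithConv (A →ₗ[R] A)) ^ n) a = 0) :
    HasPolynomialPowers R A := by
  intro a
  obtain ⟨N, hN⟩ := h a
  set w : WithConv (A →ₗ[R] A) := toConv LinearMap.id - 1 with hw
  refine ⟨∑ k ∈ Finset.range N,
    C ((w ^ k) a) * (C (k.factorial : ℚ)⁻¹ * descPochhammer ℚ k).map (algebraMap ℚ A), fun n => ?_⟩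
  have hpow : powHom R A n a = ∑ k ∈ Finset.range (n + 1), (n.choose k) • (w ^ k) a := by
    have : toConv (powHom R A n).toLinearMap =
        ∑ k ∈ Finset.range (n + 1), (n.choose k) • w ^ k := by
      rw [toConv_powHom, ← sub_add_cancel (toConv LinearMap.id : WithConv (A →ₗ[R] A)) 1,
        (Commute.one_right _).add_pow]
      simp only [one_pow, mul_one, nsmul_eq_mul, ← hw, (Nat.cast_commute _ _).eq]
    have := congrArg (fun f : WithConv (A →ₗ[R] A) => f.ofConv a) this
    rw [WithConv.ofConv_sum, LinearMap.sum_apply] at this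
    refine this.trans (Finset.sum_congr rfl fun k _ => ?_)
    exact congrArg (fun f : A →ₗ[R] A => f a)
      (map_nsmul (WithConv.addEquiv (A →ₗ[R] A)) (n.choose k) (w ^ k))
  have hbin (k : ℕ) : ((C (k.factorial : ℚ)⁻¹ * descPochhammer ℚ k).map (algebraMap ℚ A)).eval
      (n : A) = n.choose k := by
    rw [eval_natCast_map, eval_mul, eval_C, descPochhammer_eval_eq_descFactorial,
      Nat.descFactorial_eq_factorial_mul_choose, Nat.cast_mul, inv_mul_cancel_left₀
      (by exact_mod_cast k.factorial_ne_zero), map_natCast]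
  simp only [eval_finsetSum, eval_mul, eval_C, hbin]
  rw [hpow]
  simp only [nsmul_eq_mul, mul_comm (((w ^ _) a))]
  have e1 := Finset.sum_subset (Finset.range_mono (le_max_left N (n + 1)))
    (f := fun k => ((n.choose k : ℕ) : A) * (w ^ k) a) fun k _ hk => by
      rw [hN k (by simpa using hk), mul_zero]
  have e2 := Finset.sum_subset (Finset.range_mono (le_max_right N (n + 1)))
    (f := fun k => ((n.choose k : ℕ) : A) * (w ^ k) a) fun k _ hk => by
      rw [Nat.choose_eq_zero_of_lt (by simpa using hk), Nat.cast_zero, zero_mul]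
  rw [e1, e2]

theorem HasUnipotentFibres.hasPolynomialPowers {R A : Type*} [CommRing R] [IsDomain R]
    [IsLocalRing R] [CommRing A] [HopfAlgebra R A] [Module.Flat R A] [Algebra ℚ A]
    (hU : HasUnipotentFibres R A) : HasPolynomialPowers R A := by
  refine .of_convPow_eq_zero fun a => ?_
  obtain ⟨N, hN⟩ := hU.1.exists_convPow_eq_zero (1 ⊗ₜ a)
  refine ⟨N, fun n hn => ?_⟩
  have := hN n hn
  rw [convPow_id_sub_one_baseChange] at this
  have hinj : Function.Injective (fun a : A => (1 : FractionRing R) ⊗ₜ[R] a) :=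
    Algebra.TensorProduct.includeRight_injective (IsFractionRing.injective R (FractionRing R))
  exact hinj (this.trans (tmul_zero _ _).symm)

end PolynomialPowers

/-! ### Ideals stable under the power maps -/

section CoidealPowers

open TensorProduct Coalgebra Polynomial

theorem TensorProduct.map_eq_zero_of_map_mkQ_eq_zero {R V W M N : Type*} [CommRing R]
    [AddCommGroup V] [Module R V] [AddCommGroup W] [Module R W] [AddCommGroup M] [Module R M]
    [AddCommGroup N] [Module R N] {S : Submodule R V} {T : Submodule R W} {f : V →ₗ[R] M}
    {g : W →ₗ[R] N} (hf : S ≤ LinearMap.ker f) (hg : T ≤ LinearMap.ker g) {x : V ⊗[R] W}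
    (hx : TensorProduct.map S.mkQ T.mkQ x = 0) : TensorProduct.map f g x = 0 := by
  rw [← S.liftQ_mkQ f hf, ← T.liftQ_mkQ g hg, TensorProduct.map_comp, LinearMap.comp_apply, hx,
    map_zero]

theorem Ideal.natCast_succ_mul_mem_iff {A : Type*} [CommRing A] [Algebra ℚ A] {L : Ideal A} (i : ℕ) {a : A} :
    ((i + 1 : ℕ) : A) * a ∈ L ↔ a ∈ L := by
  refine ⟨fun h => ?_, L.mul_mem_left _⟩
  have := L.mul_mem_left (algebraMap ℚ A ((i + 1 : ℕ) : ℚ)⁻¹) h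
  rwa [← map_natCast (algebraMap ℚ A), ← mul_assoc, ← map_mul,
    inv_mul_cancel₀ (by exact_mod_cast i.succ_ne_zero), map_one, one_mul] at this

variable {R A : Type*} [CommRing R] [CommRing A] [Bialgebra R A]

/-- If `f` and `g` map the coideal `I` into `L`, then so does their convolution. -/
theorem sum_mul_mem_of_comul_eq_zero {I L : Ideal A} {a : A}
    (ha : TensorProduct.map (I.restrictScalars R).mkQ (I.restrictScalars R).mkQ
      (comul (R := R) a) = 0)
    {f g : A →ₗ[R] A} (hf : ∀ x ∈ I, f x ∈ L) (hg : ∀ x ∈ I, g x ∈ L)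
    {ι : Type*} (r : Repr R a ι) :
    ∑ k ∈ r.index, f (r.left k) * g (r.right k) ∈ L := by
  let q := (Ideal.Quotient.mkₐ R L)
  have h := TensorProduct.map_eq_zero_of_map_mkQ_eq_zero
    (f := q.toLinearMap ∘ₗ f) (g := q.toLinearMap ∘ₗ g)
    (fun x hx => Ideal.Quotient.eq_zero_iff_mem.mpr (hf x hx))
    (fun x hx => Ideal.Quotient.eq_zero_iff_mem.mpr (hg x hx)) ha
  have := congrArg (LinearMap.mul' R (A ⧸ L)) h
  simp only [← r.eq, map_sum, map_tmul, map_zero, LinearMap.mul'_apply] at this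
  rw [← Ideal.Quotient.eq_zero_iff_mem, map_sum, ← this]
  rfl

variable {I : Ideal A}
  (hΔ : ∀ a ∈ I, TensorProduct.map (I.restrictScalars R).mkQ (I.restrictScalars R).mkQ
      (comul (R := R) a) = 0)
  (hε : ∀ a ∈ I, algebraMap R A (counit a) ∈ I)

include hΔ hε in
theorem powHom_mem (n : ℕ) {a : A} (ha : a ∈ I) : powHom R A n a ∈ I := by
  induction n generalizing a with
  | zero => exact hε a ha
  | succ n ih =>
    rw [← sum_powHom_mul_powHom (ℛ R a)]
    exact sum_mul_mem_of_comul_eq_zero (f := (powHom R A n).toLinearMap)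
      (g := (powHom R A 1).toLinearMap) (hΔ a ha) (fun x hx => ih hx)
      (fun x hx => by rwa [AlgHom.toLinearMap_apply, powHom_one]) _

variable [Algebra ℚ A] (hA : HasPolynomialPowers R A)

namespace HasPolynomialPowers

include hΔ hε in
theorem component_mem (i : ℕ) {a : A} (ha : a ∈ I) : hA.component i a ∈ I := by
  have h0 : (hA.powPoly a).map (Ideal.Quotient.mk I) = 0 := eq_of_eval_natCast_eq fun n => by
    rw [eval_natCast_map, eval_powPoly, eval_zero]
    exact Ideal.Quotient.eq_zero_iff_mem.mpr (powHom_mem hΔ hε n ha)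
  rw [component_apply, ← Ideal.Quotient.eq_zero_iff_mem, ← coeff_map, h0, coeff_zero]

include hΔ in
theorem component_succ_mem {L : Ideal A} (hL : ∀ a ∈ I, hA.component 1 a ∈ L) (i : ℕ) {a : A}
    (ha : a ∈ I) : hA.component (i + 1) a ∈ L := by
  induction i generalizing a with
  | zero => exact hL a ha
  | succ i ih =>
    rw [← Ideal.natCast_succ_mul_mem_iff (i + 1), ← sum_component_one_mul_component hA (ℛ R a)]
    exact sum_mul_mem_of_comul_eq_zero (hΔ a ha) hL (fun x hx => ih hx) _

include hΔ in
/-- Up to constants, a biideal is contained in any ideal containing the logarithms of its elements: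
the components of an element are, up to factorials, convolution powers of the logarithm. -/
theorem sub_counit_mem {L : Ideal A} (hL : ∀ a ∈ I, hA.component 1 a ∈ L) {a : A} (ha : a ∈ I) :
    a - algebraMap R A (counit a) ∈ L := by
  have h := hA.sum_component (a := a) (N := (hA.powPoly a).natDegree + 1) (Nat.lt_succ_self _)
  rw [Finset.sum_range_succ', component_zero] at h
  rw [← eq_sub_iff_add_eq.mpr h]
  exact L.sum_mem fun i _ => hA.component_succ_mem hΔ hL i ha

/-- The logarithm is a derivation at the unit section, so its image is finitely generated. -/
theorem fg_range_component_one [Algebra.FiniteType R A] :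
    (LinearMap.range (hA.component 1)).FG := by
  obtain ⟨s, hs⟩ := Algebra.FiniteType.out (R := R) (A := A)
  refine ⟨(s.finite_toSet.image (hA.component 1)).toFinset, le_antisymm ?_ ?_⟩
  · rw [Submodule.span_le]
    intro x hx
    obtain ⟨a, -, rfl⟩ : ∃ a ∈ s, hA.component 1 a = x := by simpa using hx
    exact ⟨a, rfl⟩
  · rintro _ ⟨a, rfl⟩
    have ha : a ∈ Algebra.adjoin R (s : Set A) := by rw [hs]; trivial
    induction ha using Algebra.adjoin_induction with
    | mem x hx => exact Submodule.subset_span (by simpa using ⟨x, hx, rfl⟩)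
    | algebraMap r => rw [component_one_algebraMap]; exact zero_mem _
    | add x y _ _ hx hy => rw [map_add]; exact add_mem hx hy
    | mul x y _ _ hx hy =>
      rw [component_one_mul, ← Algebra.smul_def, mul_comm _ (algebraMap R A _), ← Algebra.smul_def]
      exact add_mem (Submodule.smul_mem _ _ hy) (Submodule.smul_mem _ _ hx)

theorem component_mem_pow [Algebra ℚ R] [IsScalarTower ℚ R A] (i : ℕ) (a : A) :
    hA.component i a ∈ LinearMap.range (hA.component 1) ^ i := by
  induction i generalizing a with
  | zero =>
    rw [component_zero, pow_zero, Submodule.one_eq_range]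
    exact ⟨_, rfl⟩
  | succ i ih =>
    have h : ((i + 1 : ℕ) : A) * hA.component (i + 1) a ∈
        LinearMap.range (hA.component 1) ^ (i + 1) := by
      rw [← sum_component_one_mul_component hA (ℛ R a), pow_succ']
      exact Submodule.sum_mem _ fun k _ => Submodule.mul_mem_mul ⟨_, rfl⟩ (ih _)
    have := Submodule.smul_mem _ (algebraMap ℚ R ((i + 1 : ℕ) : ℚ)⁻¹) h
    rwa [algebraMap_smul, Algebra.smul_def, ← map_natCast (algebraMap ℚ A), ← mul_assoc, ← map_mul,
      inv_mul_cancel₀ (by exact_mod_cast i.succ_ne_zero), map_one, one_mul] at this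

theorem fg_range_component [Algebra ℚ R] [IsScalarTower ℚ R A] [IsNoetherianRing R]
    [Algebra.FiniteType R A] (i : ℕ) : (LinearMap.range (hA.component i)).FG :=
  (hA.fg_range_component_one.pow i).of_le <| by
    rintro _ ⟨a, rfl⟩
    exact hA.component_mem_pow i a

end HasPolynomialPowers

end CoidealPowers

/-! ### Finite modules over a complete local ring -/

section Finite

open TensorProduct IsLocalRing

variable {R : Type*} [CommRing R]

theorem IsPrecomplete.of_finite (𝔞 : Ideal R) [IsPrecomplete 𝔞 R] (M : Type*) [AddCommGroup M]
    [Module R M] [Module.Finite R M] : IsPrecomplete 𝔞 M := by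
  rw [← AdicCompletion.of_surjective_iff, ← LinearMap.range_eq_top, eq_top_iff]
  rintro x -
  obtain ⟨y, rfl⟩ := AdicCompletion.ofTensorProduct_surjective_of_finite 𝔞 M x
  induction y with
  | zero => rw [map_zero]; exact zero_mem _
  | add y z hy hz => rw [map_add]; exact add_mem hy hz
  | tmul r m =>
    obtain ⟨s, rfl⟩ := AdicCompletion.of_surjective 𝔞 R r
    refine ⟨s • m, ?_⟩
    rw [AdicCompletion.ofTensorProduct_tmul]
    ext n
    rfl

theorem mem_smul_top_of_map_mkQ_eq_zero {M N : Type*} [AddCommGroup M] [Module R M] [AddCommGroup N]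
    [Module R N] (𝔞 : Ideal R) (x : M ⊗[R] N)
    (hx : TensorProduct.map (𝔞 • ⊤ : Submodule R M).mkQ (𝔞 • ⊤ : Submodule R N).mkQ x = 0) :
    x ∈ (𝔞 • ⊤ : Submodule R (M ⊗[R] N)) := by
  rw [← LinearMap.mem_ker, TensorProduct.map_ker (LinearMap.exact_subtype_mkQ _)
    (Submodule.mkQ_surjective _) (LinearMap.exact_subtype_mkQ _) (Submodule.mkQ_surjective _)] at hx
  refine (sup_le ?_ ?_ : _ ≤ (𝔞 • ⊤ : Submodule R (M ⊗[R] N))) hx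
  · rintro _ ⟨y, rfl⟩
    induction y with
    | zero => rw [map_zero]; exact zero_mem _
    | add y z hy hz => rw [map_add]; exact add_mem hy hz
    | tmul m n =>
      rw [LinearMap.lTensor_tmul]
      exact Submodule.smul_top_le_comap_smul_top 𝔞 (TensorProduct.mk R M N m) n.2
  · rintro _ ⟨y, rfl⟩
    induction y with
    | zero => rw [map_zero]; exact zero_mem _
    | add y z hy hz => rw [map_add]; exact add_mem hy hz
    | tmul m n =>
      rw [LinearMap.rTensor_tmul]
      exact Submodule.smul_top_le_comap_smul_top 𝔞 ((TensorProduct.mk R M N).flip n) m.2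

/-- Krull's intersection theorem for a tensor product of finite modules. -/
theorem eq_zero_of_forall_map_mkQ_eq_zero [IsNoetherianRing R] [IsLocalRing R] {M N : Type*}
    [AddCommGroup M] [Module R M] [AddCommGroup N] [Module R N] [Module.Finite R M]
    [Module.Finite R N] (x : M ⊗[R] N)
    (hx : ∀ n : ℕ, TensorProduct.map (maximalIdeal R ^ n • ⊤ : Submodule R M).mkQ
      (maximalIdeal R ^ n • ⊤ : Submodule R N).mkQ x = 0) : x = 0 :=
  IsHausdorff.haus (I := maximalIdeal R) inferInstance x fun n =>
    SModEq.zero.mpr (mem_smul_top_of_map_mkQ_eq_zero _ x (hx n))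

end Finite

/-! ### The truncations of a closed formal subgroup -/

section FormalSubgroup

open TensorProduct Coalgebra IsLocalRing

variable {R : Type*} [CommRing R] [IsLocalRing R]

theorem algebraMap_mem_piIdeal_pow (B : Type*) [CommRing B] [Algebra R B] {n : ℕ} {r : R}
    (hr : r ∈ maximalIdeal R ^ n) : algebraMap R B r ∈ piIdeal R B ^ n := by
  rw [piIdeal, ← Ideal.map_pow]
  exact Ideal.mem_map_of_mem _ hr

theorem restrictScalars_piIdeal_pow (B : Type*) [CommRing B] [Algebra R B] (n : ℕ) :
    (piIdeal R B ^ n).restrictScalars R = maximalIdeal R ^ n • ⊤ := by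
  rw [Ideal.smul_top_eq_map, Ideal.map_pow]

theorem map_mem_piIdeal_pow {B C : Type*} [CommRing B] [Algebra R B] [CommRing C] [Algebra R C]
    (f : B →ₐ[R] C) {n : ℕ} {b : B} (hb : b ∈ piIdeal R B ^ n) : f b ∈ piIdeal R C ^ n :=
  piIdeal_pow_le_comap f n hb

theorem PiCompletion.map_algebraMap {B C : Type*} [CommRing B] [Algebra R B] [CommRing C]
    [Algebra R C] (f : B →ₐ[R] C) (b : B) :
    PiCompletion.map f (algebraMap B _ b) = algebraMap C _ (f b) := by
  refine AdicCompletion.ext_evalₐ fun n => ?_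
  rw [PiCompletion.evalₐ_map, AlgHom.commutes, AlgHom.commutes]
  rfl

section Level

variable {B : Type*} [CommRing B] [Algebra R B] (J : Ideal (PiCompletion R B))

/-- The ideal of functions on `Spec B` whose restriction to the closed formal subscheme cut
out by `J` vanishes modulo `πⁿ`. -/
noncomputable def levelIdeal (n : ℕ) : Ideal B :=
  (J.map (AdicCompletion.evalₐ (piIdeal R B) n)).comap (Ideal.Quotient.mk (piIdeal R B ^ n))

variable {J}

theorem mem_levelIdeal {n : ℕ} {b : B} : b ∈ levelIdeal J n ↔
    ∃ j ∈ J, AdicCompletion.evalₐ (piIdeal R B) n j = Ideal.Quotient.mk _ b := by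
  rw [levelIdeal, Ideal.mem_comap, Ideal.mem_map_iff_of_surjective _
    (AdicCompletion.surjective_evalₐ _ n)]

theorem piIdeal_pow_le_levelIdeal (n : ℕ) : piIdeal R B ^ n ≤ levelIdeal J n := fun b hb =>
  mem_levelIdeal.mpr ⟨0, J.zero_mem, by
    rw [map_zero, eq_comm, Ideal.Quotient.eq_zero_iff_mem]; exact hb⟩

theorem mem_of_forall_evalₐ_mem (hfg : (maximalIdeal R).FG)
    (hJ : IsHausdorff (maximalIdeal R) (PiCompletion R B ⧸ J)) {x : PiCompletion R B}
    (hx : ∀ n, ∃ j ∈ J, AdicCompletion.evalₐ (piIdeal R B) n j =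
      AdicCompletion.evalₐ (piIdeal R B) n x) : x ∈ J := by
  rw [← Ideal.Quotient.eq_zero_iff_mem]
  refine hJ.haus _ fun n => ?_
  obtain ⟨j, hj, hjx⟩ := hx n
  have h1 : x - j ∈ (piIdeal R B ^ n • ⊤ : Submodule B (PiCompletion R B)) := by
    rw [AdicCompletion.pow_smul_top_eq_ker_eval (hfg.map _), LinearMap.mem_ker]
    rw [← AdicCompletion.factor_evalₐ_eq_eval (h := by simp), map_sub, hjx, sub_self, map_zero]
  have h2 : Ideal.Quotient.mk J x = Ideal.Quotient.mk J (x - j) := by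
    rw [map_sub, Ideal.Quotient.eq_zero_iff_mem.mpr hj, sub_zero]
  rw [SModEq.zero, h2, ← restrictScalars_piIdeal_pow]
  refine Submodule.smul_induction_on h1 (fun b hb y _ => ?_) fun y z hy hz => ?_
  · rw [Algebra.smul_def, map_mul]
    exact Ideal.mul_mem_right _ _ (map_mem_piIdeal_pow (PiCompletion.toQuotient J) hb)
  · rw [map_add]
    exact add_mem hy hz

theorem mem_comap_iff_forall_mem_levelIdeal (hfg : (maximalIdeal R).FG)
    (hJ : IsHausdorff (maximalIdeal R) (PiCompletion R B ⧸ J)) {b : B} :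
    b ∈ J.comap (algebraMap B (PiCompletion R B)) ↔ ∀ n, b ∈ levelIdeal J n := by
  have h (n : ℕ) : AdicCompletion.evalₐ (piIdeal R B) n (algebraMap B (PiCompletion R B) b) =
    Ideal.Quotient.mk _ b := AlgHom.commutes _ b
  refine ⟨fun hb n => mem_levelIdeal.mpr ⟨_, hb, h n⟩, fun hb => ?_⟩
  refine mem_of_forall_evalₐ_mem hfg hJ fun n => ?_
  rw [h]
  exact mem_levelIdeal.mp (hb n)

/-- A closed formal subscheme which coincides with `V(I)` modulo every power of `π` is the completion
of `V(I)`. -/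
theorem completionIdeal_eq (hfg : (maximalIdeal R).FG)
    (hJ : IsHausdorff (maximalIdeal R) (PiCompletion R B ⧸ J)) {I : Ideal B}
    (hI : ∀ n, levelIdeal J n = I ⊔ piIdeal R B ^ n) :
    RingHom.ker (PiCompletion.map (Ideal.Quotient.mkₐ R I)) = J := by
  have key (x : PiCompletion R B) (n : ℕ) :
      AdicCompletion.evalₐ _ n (PiCompletion.map (Ideal.Quotient.mkₐ R I) x) = 0 ↔
        ∃ j ∈ J, AdicCompletion.evalₐ (piIdeal R B) n j =
          AdicCompletion.evalₐ (piIdeal R B) n x := by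
    obtain ⟨b, hb⟩ := Ideal.Quotient.mk_surjective (AdicCompletion.evalₐ (piIdeal R B) n x)
    have hmap : piIdeal R (B ⧸ I) ^ n = (piIdeal R B ^ n).map (Ideal.Quotient.mk I) := by
      rw [Ideal.map_pow, piIdeal, Ideal.map_map]
      rfl
    rw [PiCompletion.evalₐ_map, ← hb, ← mem_levelIdeal, hI, sup_comm]
    change Ideal.Quotient.mk _ (Ideal.Quotient.mk I b) = 0 ↔ _
    rw [Ideal.Quotient.eq_zero_iff_mem, hmap, ← Ideal.mem_comap,
      Ideal.comap_map_of_surjective _ Ideal.Quotient.mk_surjective, ← RingHom.ker_eq_comap_bot,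
      Ideal.mk_ker]
  ext x
  rw [RingHom.mem_ker]
  constructor
  · intro hx
    exact mem_of_forall_evalₐ_mem hfg hJ fun n => (key x n).mp (by rw [hx, map_zero])
  · intro hx
    exact AdicCompletion.ext_evalₐ fun n => by
      rw [map_zero, key]
      exact ⟨x, hx, rfl⟩

/-- Reduction modulo `πⁿ` of functions on the closed formal subscheme cut out by `J`. -/
noncomputable def quotientToLevel (n : ℕ) : (PiCompletion R B ⧸ J) →ₐ[R] B ⧸ levelIdeal J n :=
  Ideal.Quotient.liftₐ J
    ((Ideal.Quotient.factorₐ R (piIdeal_pow_le_levelIdeal (J := J) n)).comp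
      ((AdicCompletion.evalₐ (piIdeal R B) n).restrictScalars R)) fun j hj => by
    obtain ⟨b, hb⟩ := Ideal.Quotient.mk_surjective (AdicCompletion.evalₐ (piIdeal R B) n j)
    have : Ideal.Quotient.mk (levelIdeal J n) b = 0 :=
      Ideal.Quotient.eq_zero_iff_mem.mpr (mem_levelIdeal.mpr ⟨j, hj, hb.symm⟩)
    rw [AlgHom.comp_apply, AlgHom.restrictScalars_apply, ← hb]
    exact this

theorem quotientToLevel_comp_toQuotient (n : ℕ) :
    (quotientToLevel n).comp (PiCompletion.toQuotient J) =
      Ideal.Quotient.mkₐ R (levelIdeal J n) := by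
  ext b
  change Ideal.Quotient.factorₐ R (piIdeal_pow_le_levelIdeal (J := J) n)
    (AdicCompletion.evalₐ (piIdeal R B) n (algebraMap B _ b)) = _
  rw [AlgHom.commutes]
  rfl

end Level

namespace IsClosedFormalSubgroup

variable {A : Type*} [CommRing A] [HopfAlgebra R A] {J : Ideal (PiCompletion R A)}
  (hJ : IsClosedFormalSubgroup J)

include hJ

theorem counit_mem_of_mem_levelIdeal {n : ℕ} {a : A} (ha : a ∈ levelIdeal J n) :
    Coalgebra.counit (R := R) a ∈ maximalIdeal R ^ n := by
  obtain ⟨j, hj, hja⟩ := mem_levelIdeal.mp ha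
  have h := congrArg (AdicCompletion.evalₐ _ n) (hJ.counit j hj)
  rw [PiCompletion.evalₐ_map, hja, map_zero] at h
  have h' := Ideal.Quotient.eq_zero_iff_mem.mp h
  rwa [piIdeal, Algebra.algebraMap_self, Ideal.map_id] at h'

/-- Modulo `πⁿ` the completed tensor product `(Q ⊗ Q)^` of `Q = Â / J` is that of the quotients
`A / Jₙ`, so that the formal coideal condition becomes the usual one. -/
theorem comul_of_mem_levelIdeal {n : ℕ} {a : A} (ha : a ∈ levelIdeal J n) :
    TensorProduct.map ((levelIdeal J n).restrictScalars R).mkQ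
      ((levelIdeal J n).restrictScalars R).mkQ (Coalgebra.comul (R := R) a) = 0 := by
  obtain ⟨j, hj, hja⟩ := mem_levelIdeal.mp ha
  set p := PiCompletion.toQuotient J
  have h := congrArg (AdicCompletion.evalₐ _ n) (hJ.comul j hj)
  rw [PiCompletion.evalₐ_map, PiCompletion.evalₐ_map, hja, map_zero] at h
  have h' : Algebra.TensorProduct.map p p (Coalgebra.comul (R := R) a) ∈ piIdeal R _ ^ n :=
    Ideal.Quotient.eq_zero_iff_mem.mp h
  have h2 := map_mem_piIdeal_pow (Algebra.TensorProduct.map (quotientToLevel (J := J) n)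
    (quotientToLevel (J := J) n)) h'
  rw [← AlgHom.comp_apply, ← Algebra.TensorProduct.map_comp,
    quotientToLevel_comp_toQuotient] at h2
  have h3 : piIdeal R ((A ⧸ levelIdeal J n) ⊗[R] (A ⧸ levelIdeal J n)) ^ n = ⊥ := by
    rw [piIdeal, ← Ideal.map_pow, Ideal.map_eq_bot_iff_le_ker]
    intro r hr
    have : algebraMap R (A ⧸ levelIdeal J n) r = 0 :=
      Ideal.Quotient.eq_zero_iff_mem.mpr
        (piIdeal_pow_le_levelIdeal n (algebraMap_mem_piIdeal_pow A hr))
    rw [RingHom.mem_ker, Algebra.TensorProduct.algebraMap_apply, this, zero_tmul]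
  rw [h3] at h2
  exact h2

end IsClosedFormalSubgroup

end FormalSubgroup

/-! ### The algebraic subgroup inducing a closed formal subgroup -/

section Algebraization

open TensorProduct IsLocalRing

theorem nonempty_algebraRat_of_charZero_residueField (R : Type*) [CommRing R] [IsLocalRing R]
    [CharZero (ResidueField R)] : Nonempty (Algebra ℚ R) := by
  rw [EqualCharZero.nonempty_algebraRat_iff]
  intro I hI
  have : CharZero (R ⧸ maximalIdeal R) := inferInstanceAs (CharZero (ResidueField R))
  exact RingHom.charZero (Ideal.Quotient.factor (le_maximalIdeal hI))

variable {R : Type*} [CommRing R] [IsLocalRing R] {A : Type*} [CommRing A] [HopfAlgebra R A]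

theorem map_mem_smul_top {M : Type*} [AddCommGroup M] [Module R M] (f : A →ₗ[R] M) {n : ℕ} {a : A}
    (ha : a ∈ piIdeal R A ^ n) : f a ∈ (maximalIdeal R ^ n • ⊤ : Submodule R M) := by
  have ha' : a ∈ (piIdeal R A ^ n).restrictScalars R := ha
  rw [restrictScalars_piIdeal_pow] at ha'
  exact Submodule.smul_top_le_comap_smul_top _ f ha'

namespace IsClosedFormalSubgroup

variable {J : Ideal (PiCompletion R A)} (hJ : IsClosedFormalSubgroup J)

include hJ

theorem algebraMap_counit_mem {n : ℕ} {a : A} (ha : a ∈ levelIdeal J n) :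
    algebraMap R A (Coalgebra.counit a) ∈ piIdeal R A ^ n :=
  algebraMap_mem_piIdeal_pow A (hJ.counit_mem_of_mem_levelIdeal ha)

theorem mem_comap_iff [IsNoetherianRing R] {a : A} :
    a ∈ J.comap (algebraMap A (PiCompletion R A)) ↔ ∀ n, a ∈ levelIdeal J n :=
  mem_comap_iff_forall_mem_levelIdeal (IsNoetherian.noetherian _) hJ.complete.toIsHausdorff

variable [Algebra ℚ A] (hA : HasPolynomialPowers R A)

include hA

theorem component_mem_levelIdeal (i : ℕ) {n : ℕ} {a : A} (ha : a ∈ levelIdeal J n) :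
    hA.component i a ∈ levelIdeal J n :=
  hA.component_mem (fun _ h => hJ.comul_of_mem_levelIdeal h)
    (fun _ h => piIdeal_pow_le_levelIdeal n (hJ.algebraMap_counit_mem h)) i ha

variable [IsNoetherianRing R]

theorem component_mem_comap (i : ℕ) {a : A} (ha : a ∈ J.comap (algebraMap A (PiCompletion R A))) :
    hA.component i a ∈ J.comap (algebraMap A (PiCompletion R A)) := by
  rw [hJ.mem_comap_iff] at ha ⊢
  exact fun n => hJ.component_mem_levelIdeal hA i (ha n)

/-- The logarithms lie in a finite, hence complete, `R`-module; so the logarithm of a function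
vanishing on the formal subgroup modulo `πⁿ` is congruent modulo `πⁿ` to a function which vanishes
on the formal subgroup. -/
theorem component_one_mem_sup [IsPrecomplete (maximalIdeal R) R] [Algebra.FiniteType R A]
    {n : ℕ} {a : A} (ha : a ∈ levelIdeal J n) :
    hA.component 1 a ∈ J.comap (algebraMap A (PiCompletion R A)) ⊔ piIdeal R A ^ n := by
  obtain ⟨j, hj, hja⟩ := mem_levelIdeal.mp ha
  obtain ⟨f, rfl⟩ := AdicCompletion.mk_surjective _ _ j
  have hf (k : ℕ) : f k ∈ levelIdeal J k :=
    mem_levelIdeal.mpr ⟨_, hj, AdicCompletion.evalₐ_mk _ _ _⟩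
  have hcauchy {k l : ℕ} (hkl : k ≤ l) : f k - f l ∈ piIdeal R A ^ k := by
    have := f.2 hkl
    rwa [SModEq.sub_mem, smul_eq_mul, Ideal.mul_top] at this
  have hfa : a - f n ∈ piIdeal R A ^ n := by
    rwa [AdicCompletion.evalₐ_mk, eq_comm, Ideal.Quotient.eq] at hja
  let P := LinearMap.range (hA.component 1)
  have : Module.Finite R P := Module.Finite.iff_fg.mpr hA.fg_range_component_one
  have : IsPrecomplete (maximalIdeal R) P := .of_finite _ P
  let e : A →ₗ[R] P := (hA.component 1).rangeRestrict
  obtain ⟨x, hx⟩ := IsPrecomplete.prec (I := maximalIdeal R) (M := P) inferInstance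
    (f := fun k => e (f k)) fun {k l} hkl => by
      rw [SModEq.sub_mem, ← map_sub]
      exact map_mem_smul_top e (hcauchy hkl)
  have hx' (k : ℕ) : hA.component 1 (f k) - x ∈ piIdeal R A ^ k := by
    have h1 := Submodule.smul_top_le_comap_smul_top _ P.subtype (SModEq.sub_mem.mp (hx k))
    rw [Submodule.mem_comap, ← restrictScalars_piIdeal_pow] at h1
    exact h1
  have hxJ : (x : A) ∈ J.comap (algebraMap A (PiCompletion R A)) := by
    rw [hJ.mem_comap_iff]
    intro k
    have := sub_mem (hJ.component_mem_levelIdeal hA 1 (hf k)) (piIdeal_pow_le_levelIdeal k (hx' k))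
    rwa [sub_sub_cancel] at this
  have h2 : hA.component 1 (a - f n) ∈ piIdeal R A ^ n := by
    have := map_mem_smul_top (hA.component 1) hfa
    rwa [← restrictScalars_piIdeal_pow] at this
  have h3 : hA.component 1 a =
      x + (hA.component 1 (a - f n) + (hA.component 1 (f n) - x)) := by
    rw [map_sub]; ring
  rw [h3]
  exact Submodule.add_mem_sup hxJ (add_mem h2 (hx' n))

theorem levelIdeal_eq_sup [IsPrecomplete (maximalIdeal R) R] [Algebra.FiniteType R A] (n : ℕ) :
    levelIdeal J n = J.comap (algebraMap A (PiCompletion R A)) ⊔ piIdeal R A ^ n := by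
  refine le_antisymm (fun a ha => ?_) (sup_le (fun a ha => ?_) (piIdeal_pow_le_levelIdeal n))
  · rw [← sub_add_cancel a (algebraMap R A (Coalgebra.counit a))]
    exact add_mem (hA.sub_counit_mem (fun _ h => hJ.comul_of_mem_levelIdeal h)
      (fun _ h => hJ.component_one_mem_sup hA h) ha)
      (Ideal.mem_sup_right (hJ.algebraMap_counit_mem ha))
  · exact hJ.mem_comap_iff.mp ha n

/-- The functions on the group vanishing on the formal subgroup form a coideal. Since the
components have finite rank, Krull's intersection theorem can be applied to each component
although it is not available for `A / I ⊗ A / I` itself. -/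
theorem comul_of_mem_comap [IsPrecomplete (maximalIdeal R) R] [Algebra.FiniteType R A]
    [Algebra ℚ R] [IsScalarTower ℚ R A] {a : A}
    (ha : a ∈ J.comap (algebraMap A (PiCompletion R A))) :
    TensorProduct.map ((J.comap (algebraMap A (PiCompletion R A))).restrictScalars R).mkQ
      ((J.comap (algebraMap A (PiCompletion R A))).restrictScalars R).mkQ
      (Coalgebra.comul (R := R) a) = 0 := by
  set I := J.comap (algebraMap A (PiCompletion R A)) with hI
  let q := (I.restrictScalars R).mkQ
  let f (i : ℕ) := q ∘ₗ hA.component i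
  have hfin (i : ℕ) : Module.Finite R (LinearMap.range (f i)) := by
    rw [Module.Finite.iff_fg, LinearMap.range_comp]
    exact (hA.fg_range_component i).map q
  have hlevel (i n : ℕ) : (levelIdeal J n).restrictScalars R ≤ LinearMap.ker
      ((maximalIdeal R ^ n • ⊤ : Submodule R (LinearMap.range (f i))).mkQ ∘ₗ
        (f i).rangeRestrict) := by
    intro b hb
    have hb' : b ∈ levelIdeal J n := hb
    rw [hJ.levelIdeal_eq_sup hA, Submodule.mem_sup] at hb'
    obtain ⟨y, hy, z, hz, rfl⟩ := hb'
    have hy0 : (f i).rangeRestrict y = 0 := by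
      ext
      exact (Submodule.Quotient.mk_eq_zero _).mpr (hJ.component_mem_comap hA i hy)
    rw [LinearMap.mem_ker, LinearMap.comp_apply, map_add, hy0, zero_add, Submodule.mkQ_apply,
      Submodule.Quotient.mk_eq_zero]
    exact map_mem_smul_top _ hz
  have hij (i j : ℕ) : TensorProduct.map (f i) (f j) (Coalgebra.comul (R := R) a) = 0 := by
    have h0 : TensorProduct.map (f i).rangeRestrict (f j).rangeRestrict
        (Coalgebra.comul (R := R) a) = 0 := by
      refine eq_zero_of_forall_map_mkQ_eq_zero _ fun n => ?_
      rw [← LinearMap.comp_apply, ← TensorProduct.map_comp]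
      exact TensorProduct.map_eq_zero_of_map_mkQ_eq_zero (hlevel i n) (hlevel j n)
        (hJ.comul_of_mem_levelIdeal (hJ.mem_comap_iff.mp ha n))
    have := congrArg (TensorProduct.map (LinearMap.range (f i)).subtype
      (LinearMap.range (f j)).subtype) h0
    rw [← LinearMap.comp_apply, ← TensorProduct.map_comp, map_zero] at this
    exact this
  let r := Coalgebra.Repr.arbitrary R a
  obtain ⟨N, hN⟩ : ∃ N, ∀ k ∈ r.index, (hA.powPoly (r.left k)).natDegree < N ∧
      (hA.powPoly (r.right k)).natDegree < N := by
    refine ⟨r.index.sup (fun k => max (hA.powPoly (r.left k)).natDegree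
      (hA.powPoly (r.right k)).natDegree) + 1, fun k hk => ?_⟩
    rw [← max_lt_iff, Nat.lt_succ_iff]
    exact Finset.le_sup (f := fun k => max (hA.powPoly (r.left k)).natDegree
      (hA.powPoly (r.right k)).natDegree) hk
  have hsum : ∑ i ∈ Finset.range N, ∑ j ∈ Finset.range N,
      TensorProduct.map (f i) (f j) (Coalgebra.comul (R := R) a) =
        TensorProduct.map q q (Coalgebra.comul (R := R) a) := by
    simp only [← r.eq, map_sum, TensorProduct.map_tmul]
    rw [Finset.sum_congr rfl fun _ _ => Finset.sum_comm, Finset.sum_comm]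
    refine Finset.sum_congr rfl fun k hk => ?_
    simp only [← tmul_sum, ← sum_tmul]
    simp only [f, LinearMap.comp_apply, ← map_sum]
    rw [hA.sum_component (hN k hk).1, hA.sum_component (hN k hk).2]
  rw [← hsum]
  exact Finset.sum_eq_zero fun i _ => Finset.sum_eq_zero fun j _ => hij i j

theorem isHopfIdeal_comap [IsPrecomplete (maximalIdeal R) R] [Algebra.FiniteType R A]
    [Algebra ℚ R] [IsScalarTower ℚ R A] :
    (J.comap (algebraMap A (PiCompletion R A))).IsHopfIdeal R where
  counit_eq_zero a ha := by
    refine IsHausdorff.haus (I := maximalIdeal R) (M := R) inferInstance _ fun n => ?_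
    rw [SModEq.zero, smul_eq_mul, Ideal.mul_top]
    exact hJ.counit_mem_of_mem_levelIdeal (hJ.mem_comap_iff.mp ha n)
  map_mkQ_comul_eq_zero a ha := hJ.comul_of_mem_comap hA ha
  antipode_mem a ha := by
    have := hJ.antipode _ ha
    rwa [PiCompletion.map_algebraMap] at this

end IsClosedFormalSubgroup

theorem flat_quotient_comap [IsDedekindDomain R] {B : Type*} [CommRing B]
    [Algebra R B] (J : Ideal (PiCompletion R B)) [Module.Flat R (PiCompletion R B ⧸ J)] :
    Module.Flat R (B ⧸ J.comap (algebraMap B (PiCompletion R B))) := by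
  let g : (B ⧸ J.comap (algebraMap B (PiCompletion R B))) →ₐ[R] (PiCompletion R B ⧸ J) :=
    Ideal.quotientMapₐ J (Algebra.algHom R B (PiCompletion R B)) le_rfl
  have hg : Function.Injective g := Ideal.quotientMap_injective
  have : Module.IsTorsionFree R (B ⧸ J.comap (algebraMap B (PiCompletion R B))) :=
    hg.moduleIsTorsionFree g fun r x => map_smul g r x
  infer_instance

end Algebraization

/-- `A` is the Hopf algebra of the group scheme `U`, `J` the ideal of the formal subgroup, and `I`
the ideal of the subgroup of `U` whose completion it is. -/
theorem proposition11p07 {R : Type*} [CommRing R] [IsDomain R] [IsDiscreteValuationRing R]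
    [IsAdicComplete (IsLocalRing.maximalIdeal R) R]
    [CharZero (FractionRing R)] [CharZero (IsLocalRing.ResidueField R)]
    {A : Type*} [CommRing A] [HopfAlgebra R A] [Module.Flat R A] [Algebra.FiniteType R A]
    (hU : HasUnipotentFibres R A)
    (J : Ideal (PiCompletion R A)) (hJ : IsClosedFormalSubgroup J)
    (hflat : Module.Flat R (PiCompletion R A ⧸ J)) :
    ∃ I : Ideal A, I.IsHopfIdeal R ∧ Module.Flat R (A ⧸ I) ∧ completionIdeal (R := R) I = J := by
  obtain ⟨_⟩ := nonempty_algebraRat_of_charZero_residueField R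
  let _ : Algebra ℚ A := ((algebraMap R A).comp (algebraMap ℚ R)).toAlgebra
  have : IsScalarTower ℚ R A := .of_algebraMap_eq fun _ => rfl
  have hA := hU.hasPolynomialPowers
  exact ⟨J.comap (algebraMap A (PiCompletion R A)), hJ.isHopfIdeal_comap hA,
    flat_quotient_comap J, completionIdeal_eq (IsNoetherian.noetherian _)
      hJ.complete.toIsHausdorff (hJ.levelIdeal_eq_sup hA)⟩
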